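/- Let $S^1=\mathbb R/2\pi\mathbb Z$ carry the standard metric $g_s=d\theta\otimes d\theta$. For a positive smooth function $u$ on $S^1$ write $g=u^{-4}g_s$, $d\sigma=u^{-2}\,d\theta$, $$R_g=u^3(4u_{\theta\theta}+u),\qquad \overline R_g=\frac{\int_{S^1}R_g\,d\sigma}{\int_{S^1}d\sigma}.$$ Let $u_0$ be a positive smooth function on $S^1$ with $\int_0^{2\pi}u_0^{-2}\,d\theta=2\pi$. Then there is a constant $C>0$, depending only on $u_0$, such that for every positive smooth function $u$ on $S^1\times[0,\infty)$ for which $g(t)=u(\cdot,t)^{-4}g_s$ solves the normalized one-dimensional Yamabe flow $$\partial_t g=(\overline R_g-R_g)\,g,\qquad g(0)=u_0^{-4}g_s,$$ one has $$\frac{|\nabla_{g_s}u|}{u}\le C\quad\Big(\text{equivalently } -C\le \frac{u_\theta}{u}\le C\Big)\qquad\text{and}\qquad \frac1C\le u\le C$$ at every point of $S^1$ and for all $t\in[0,\infty)$. -/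

import Mathlib

open Set
open scoped ContDiff

namespace YamabeFlow

noncomputable section

/-- The unit circle `ℝ / 2πℤ`, with angular coordinate `θ` and standard metric `g_s = dθ ⊗ dθ`. -/
abbrev S1 : Type := AddCircle (2 * Real.pi)

/-- The derivative `f_θ` with respect to the angle, as a function on the circle. -/
def angDeriv (f : S1 → ℝ) : S1 → ℝ :=
  fun p => deriv (fun s : ℝ => f (p + (s : S1))) 0

/-- The length `|∇_{g_s} f|` of the gradient in the standard metric: since `∂_θ` is a unit vector
field for `g_s`, this is `|f_θ|`. -/
def gradNorm (f : S1 → ℝ) : S1 → ℝ :=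
  fun p => |angDeriv f p|

/-- The integral `∫_0^{2π} f dθ` over the circle. -/
def integral (f : S1 → ℝ) : ℝ :=
  ∫ θ in (0 : ℝ)..(2 * Real.pi), f (θ : S1)

/-- The coefficient `u⁻⁴` of the metric `g = u⁻⁴ g_s`. -/
def metricCoeff (u : S1 → ℝ) : S1 → ℝ :=
  fun p => (u p ^ 4)⁻¹

/-- The density `u⁻²` of the arc-length element `dσ = u⁻² dθ` of `g = u⁻⁴ g_s`. -/
def arcDensity (u : S1 → ℝ) : S1 → ℝ :=
  fun p => (u p ^ 2)⁻¹

/-- The total length `L(g) = ∫ dσ` of `g = u⁻⁴ g_s`. -/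
def arcLength (u : S1 → ℝ) : ℝ :=
  integral (arcDensity u)

/-- The (4-)scalar curvature `R_g = u³ (4 u_θθ + u)` of `g = u⁻⁴ g_s`. -/
def scalarCurv (u : S1 → ℝ) : S1 → ℝ :=
  fun p => u p ^ 3 * (4 * angDeriv (angDeriv u) p + u p)

/-- The mean curvature value `∫ R_g dσ / ∫ dσ` of `g = u⁻⁴ g_s`. -/
def meanScalarCurv (u : S1 → ℝ) : ℝ :=
  integral (fun p => scalarCurv u p * arcDensity u p) / arcLength u

/-- `u` gives a smooth solution `g(t) = u(·,t)⁻⁴ g_s`, `t ∈ [0,∞)`, of the normalized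
one-dimensional Yamabe flow `∂_t g = (mean R_g - R_g) g`, `g(0) = u₀⁻⁴ g_s`, `L(0) = 2π`.
Values of `u` at negative times are irrelevant. -/
structure IsNormalizedYamabeFlow (u₀ : S1 → ℝ) (u : ℝ → S1 → ℝ) : Prop where
  /-- `u` is smooth on `[0,∞) × S¹`. -/
  smooth : ContDiffOn ℝ ∞ (fun q : ℝ × ℝ => u q.1 (q.2 : S1)) (Ici (0 : ℝ) ×ˢ univ)
  /-- `u` is positive. -/
  pos : ∀ t, 0 ≤ t → ∀ p, 0 < u t p
  /-- The initial metric is `u₀⁻⁴ g_s`. -/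
  initial : u 0 = u₀
  /-- The initial length is `2π`. -/
  length_initial : arcLength (u 0) = 2 * Real.pi
  /-- The evolution equation for the metric (with a one-sided time derivative at `t = 0`). -/
  evolution : ∀ t, 0 ≤ t → ∀ p,
    HasDerivWithinAt (fun s : ℝ => metricCoeff (u s) p)
      ((meanScalarCurv (u t) - scalarCurv (u t) p) * metricCoeff (u t) p) (Ici 0) t

end

end YamabeFlow

/-! The proof is a moving-reflection argument. A circle map `M` with derivative `m⁻²` turns `u` into
`v = m · (u ∘ M)`, and `v⁻⁴ g_s` is the pulled-back metric. For Möbius `M` the curvature is simply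
composed with `M` (`curvature_pullback`), because `m` solves `4 m'' + m = m⁻³`. So `v(-θ) ≤ v(θ)` on
`[0, π]`, an equality at both endpoints, persists along the flow by the maximum principle
(`pullback_reflect_le`).

Here `e^{iM} = (e^{iθ} + ir)/(1 - i r e^{iθ})` is hyperbolic with fixed points `±i`, which the
reflection `θ ↦ -θ` exchanges. For `r` close to `1` the asymmetry of `log m` beats any given
multiple of the chord between reflected image points (`exists_moebius_dominates`), hence beats the
oscillation of `log u₀`. One `r` then makes the inequality true at time `0` for all rotations `c` at
once. At later times the derivative of `v(θ) - v(-θ)` has a sign at `0` and at `π`, which yields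
`|u_θ| ≤ r/(1 - r²) · u` everywhere.

Finally, the flow preserves the length `2π`, so `u(·, t)` takes the value `1`, and the gradient
bound on `log u` bounds `u` above and below. -/

namespace YamabeFlow

/-! ### Extremum conditions and the maximum principle. -/

/-- The derivative at a one-sided minimum on an interval to the right is nonnegative. -/
theorem deriv_nonneg_of_min_right {f : ℝ → ℝ} {f' a b : ℝ} (hab : a < b)
    (hf : HasDerivWithinAt f f' (Icc a b) a) (hmin : ∀ x ∈ Icc a b, f a ≤ f x) : 0 ≤ f' := by
  have h1 : IsLocalMinOn f (Icc a b) a := IsMinOn.localize hmin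
  have h2 := h1.hasFDerivWithinAt_nonneg hf.hasFDerivWithinAt
    (sub_mem_posTangentConeAt_of_segment_subset (y := b) (by rw [segment_eq_Icc hab.le]))
  simp at h2
  exact nonneg_of_mul_nonneg_right h2 (sub_pos.2 hab)

/-- The derivative at a one-sided maximum on an interval to the left is nonnegative. -/
theorem deriv_nonneg_of_max_left {f : ℝ → ℝ} {f' a b : ℝ} (hab : b < a)
    (hf : HasDerivWithinAt f f' (Icc b a) a) (hmax : ∀ x ∈ Icc b a, f x ≤ f a) : 0 ≤ f' := by
  have h1 : IsLocalMaxOn f (Icc b a) a := IsMaxOn.localize hmax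
  have h2 := h1.hasFDerivWithinAt_nonpos hf.hasFDerivWithinAt
    (sub_mem_posTangentConeAt_of_segment_subset (y := b)
      (by rw [segment_symm, segment_eq_Icc hab.le]))
  simp at h2
  nlinarith

/-- The second derivative is nonnegative at a local minimum. -/
theorem deriv_deriv_nonneg_of_isLocalMin {f : ℝ → ℝ} {a : ℝ} (hc : ContinuousAt f a)
    (h : IsLocalMin f a) : 0 ≤ deriv (deriv f) a := by
  by_contra! hneg
  -- The point would be a local maximum too, so `f` would be locally constant.
  have hmax := isLocalMax_of_deriv_deriv_neg hneg h.deriv_eq_zero hc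
  have heq : f =ᶠ[nhds a] fun _ => f a := by
    filter_upwards [h, hmax] with x h1 h2 using le_antisymm h2 h1
  have h3 : deriv (deriv f) a = 0 := by
    rw [heq.deriv.deriv_eq]; simp
  linarith

/-- A parabolic maximum principle: a function on `[0,T] × [a,b]` that is at most `1` on the
parabolic boundary stays at most `1` if its time derivative at interior spatial maxima
above `1` is at most a multiple of the excess. -/
theorem le_one_of_parabolic {T a b K : ℝ} {H H' : ℝ → ℝ → ℝ}
    (hcont : ContinuousOn (fun q : ℝ × ℝ => H q.1 q.2) (Icc 0 T ×ˢ Icc a b))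
    (h0 : ∀ x ∈ Icc a b, H 0 x ≤ 1)
    (ha : ∀ t ∈ Icc 0 T, H t a ≤ 1) (hb : ∀ t ∈ Icc 0 T, H t b ≤ 1)
    (hderiv : ∀ t ∈ Ioc 0 T, ∀ x ∈ Ioo a b,
      HasDerivWithinAt (fun s => H s x) (H' t x) (Icc 0 t) t)
    (hmax : ∀ t ∈ Ioc 0 T, ∀ x ∈ Ioo a b, 1 < H t x → IsLocalMax (H t) x →
      H' t x ≤ K * (H t x - 1)) :
    ∀ t ∈ Icc 0 T, ∀ x ∈ Icc a b, H t x ≤ 1 := by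
  intro t ht x hx
  by_contra! hlt
  -- The rate `K + 1`, rather than `K`, makes the time derivative of `Z` strictly negative at a
  -- positive maximum.
  set Z : ℝ × ℝ → ℝ := fun q => Real.exp (-(K + 1) * q.1) * (H q.1 q.2 - 1) with hZ
  have hZc : ContinuousOn Z (Icc 0 T ×ˢ Icc a b) := by
    apply ContinuousOn.mul
    · fun_prop
    · exact hcont.sub continuousOn_const
  obtain ⟨⟨t₀, x₀⟩, ⟨ht₀, hx₀⟩, hm⟩ :=
    (isCompact_Icc.prod isCompact_Icc).exists_isMaxOn ⟨(t, x), ht, hx⟩ hZc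
  simp only at ht₀ hx₀
  have hpos : 0 < Z (t₀, x₀) :=
    lt_of_lt_of_le (mul_pos (Real.exp_pos _) (sub_pos.2 hlt)) (hm (show (t, x) ∈ _ from ⟨ht, hx⟩))
  have hgt : 1 < H t₀ x₀ := by
    have := (mul_pos_iff_of_pos_left (Real.exp_pos _)).1 hpos
    simpa using this
  have htpos : 0 < t₀ := by
    rcases ht₀.1.eq_or_lt with h | h
    · subst h; exact absurd (h0 x₀ hx₀) (not_le.2 hgt)
    · exact h
  have hxa : a < x₀ := by
    rcases hx₀.1.eq_or_lt with h | h
    · subst h; exact absurd (ha t₀ ht₀) (not_le.2 hgt)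
    · exact h
  have hxb : x₀ < b := by
    rcases hx₀.2.eq_or_lt with h | h
    · subst h; exact absurd (hb t₀ ht₀) (not_le.2 hgt)
    · exact h
  have hloc : IsLocalMax (H t₀) x₀ := by
    filter_upwards [Icc_mem_nhds hxa hxb] with y hy
    have h1 : Z (t₀, y) ≤ Z (t₀, x₀) := hm (show (t₀, y) ∈ _ from ⟨ht₀, hy⟩)
    have h2 := le_of_mul_le_mul_left h1 (Real.exp_pos _)
    simpa using h2
  have hK := hmax t₀ ⟨htpos, ht₀.2⟩ x₀ ⟨hxa, hxb⟩ hgt hloc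
  have hd := hderiv t₀ ⟨htpos, ht₀.2⟩ x₀ ⟨hxa, hxb⟩
  have he : HasDerivWithinAt (fun s => Real.exp (-(K + 1) * s))
      (Real.exp (-(K + 1) * t₀) * (-(K + 1))) (Icc 0 t₀) t₀ := by
    simpa using (((hasDerivAt_id t₀).const_mul (-(K + 1))).exp).hasDerivWithinAt
  have hnn := deriv_nonneg_of_max_left htpos (he.mul (hd.sub_const 1))
    (fun s hs => hm (show (s, x₀) ∈ _ from ⟨⟨hs.1, hs.2.trans ht₀.2⟩, hx₀⟩))
  have hE := Real.exp_pos (-(K + 1) * t₀)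
  have h5 : 0 ≤ Real.exp (-(K + 1) * t₀) * (H' t₀ x₀ - (K + 1) * (H t₀ x₀ - 1)) := by
    linarith
  have h6 := nonneg_of_mul_nonneg_right h5 hE
  linarith

/-! ### Smoothness up to the initial time, and periodic functions. -/

theorem uniqueDiffOn_halfPlane : UniqueDiffOn ℝ (Ici (0 : ℝ) ×ˢ (univ : Set ℝ)) :=
  (uniqueDiffOn_Ici 0).prod uniqueDiffOn_univ

/-- The partial derivative in the second variable of a smooth function on the closed half-plane
is smooth up to the boundary. -/
theorem contDiffOn_partial_deriv {f : ℝ × ℝ → ℝ} (hf : ContDiffOn ℝ ∞ f (Ici (0 : ℝ) ×ˢ univ)) :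
    ContDiffOn ℝ ∞ (fun q : ℝ × ℝ => deriv (fun x => f (q.1, x)) q.2) (Ici (0 : ℝ) ×ˢ univ) := by
  have h1 : ContDiffOn ℝ ∞ (fderivWithin ℝ f (Ici (0 : ℝ) ×ˢ univ)) (Ici (0 : ℝ) ×ˢ univ) :=
    hf.fderivWithin uniqueDiffOn_halfPlane (by simp)
  refine (h1.clm_apply (contDiffOn_const (c := ((0 : ℝ), (1 : ℝ))))).congr ?_
  rintro ⟨t, θ⟩ hq
  have h2 := (hf.differentiableOn (by simp) (t, θ) hq).hasFDerivWithinAt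
  have h3 : HasDerivWithinAt (fun x : ℝ => (t, x)) ((0 : ℝ), (1 : ℝ)) univ θ :=
    ((hasDerivAt_const θ t).prodMk (hasDerivAt_id θ)).hasDerivWithinAt
  have h4 := h2.comp_hasDerivWithinAt θ h3 (fun x _ => ⟨hq.1, mem_univ _⟩)
  exact (hasDerivWithinAt_univ.1 h4).deriv

/-- A `2π`-periodic function with bounded derivative is Lipschitz for the chordal distance. -/
theorem abs_sub_le_of_periodic {f : ℝ → ℝ} {L : ℝ} (hf : Differentiable ℝ f)
    (hper : Function.Periodic f (2 * Real.pi)) (hL : ∀ x, |deriv f x| ≤ L) (a b : ℝ) :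
    |f a - f b| ≤ L * Real.pi * |Real.sin ((a - b) / 2)| := by
  have hL0 : 0 ≤ L := (abs_nonneg _).trans (hL 0)
  have hpi := Real.pi_pos
  set n : ℤ := round ((a - b) / (2 * Real.pi)) with hn
  have hr := abs_sub_round ((a - b) / (2 * Real.pi))
  rw [← hn] at hr
  have hfn : f (b + n * (2 * Real.pi)) = f b := hper.int_mul n b
  have h1 : |f a - f (b + n * (2 * Real.pi))| ≤ L * |a - (b + n * (2 * Real.pi))| :=
    Convex.norm_image_sub_le_of_norm_deriv_le (s := univ) (fun x _ => hf x) (fun x _ => hL x)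
      convex_univ (mem_univ _) (mem_univ _)
  -- Half the difference reduced modulo `π` to `[-π/2, π/2]`, where Jordan's inequality applies.
  set d := (a - b) / 2 - n * Real.pi with hd
  have hdd : d = Real.pi * ((a - b) / (2 * Real.pi) - n) := by rw [hd]; field_simp
  have h2 : |d| ≤ Real.pi / 2 := by
    rw [hdd, abs_mul, abs_of_pos hpi]; nlinarith
  have h3 := Real.mul_abs_le_abs_sin h2
  have h4 : |Real.sin d| = |Real.sin ((a - b) / 2)| := by
    rw [hd, Real.sin_sub_int_mul_pi, abs_mul, abs_zpow]; simp
  rw [hfn] at h1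
  have h5 : |a - (b + n * (2 * Real.pi))| = 2 * |d| := by
    rw [show a - (b + n * (2 * Real.pi)) = 2 * d by rw [hd]; ring, abs_mul]; simp
  rw [h5] at h1
  rw [h4] at h3
  have h6 : 2 * |d| ≤ Real.pi * |Real.sin ((a - b) / 2)| := by
    have := mul_le_mul_of_nonneg_left h3 hpi.le
    have e : Real.pi * (2 / Real.pi * |d|) = 2 * |d| := by field_simp
    linarith
  calc _ ≤ L * (2 * |d|) := h1
    _ ≤ L * (Real.pi * |Real.sin ((a - b) / 2)|) := by gcongr
    _ = _ := by ring

/-- A continuous periodic function is bounded in absolute value. -/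
theorem exists_abs_le_of_periodic {f : ℝ → ℝ} {c : ℝ} (hc : 0 < c) (hf : Continuous f)
    (hper : Function.Periodic f c) : ∃ L, ∀ x, |f x| ≤ L := by
  obtain ⟨L, hL⟩ := (isCompact_Icc (a := (0 : ℝ)) (b := c)).exists_bound_of_continuousOn
    hf.continuousOn
  refine ⟨L, fun x => ?_⟩
  obtain ⟨y, hy, hxy⟩ := hper.exists_mem_Ico₀ hc x
  rw [hxy]
  exact hL y ⟨hy.1, hy.2.le⟩

/-! ### Hyperbolic Möbius maps of the circle. -/

noncomputable section

/-- The reciprocal `q` of the derivative of the circle map `moebius r`. -/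
def moebiusQ (r θ : ℝ) : ℝ := (1 + r ^ 2 + 2 * r * Real.sin θ) / (1 - r ^ 2)

/-- The conformal factor `√q`. -/
def moebiusM (r θ : ℝ) : ℝ := Real.sqrt (moebiusQ r θ)

/-- The lift to `ℝ` of a hyperbolic Möbius transformation of the circle. -/
def moebius (r θ : ℝ) : ℝ :=
  θ + 2 * Real.arctan (r * Real.cos θ / (1 + r * Real.sin θ))

theorem moebius_denom_pos {r : ℝ} (h0 : 0 < r) (h1 : r < 1) (θ : ℝ) :
    0 < 1 + r * Real.sin θ := by
  nlinarith [Real.neg_one_le_sin θ]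

theorem moebius_num_pos {r : ℝ} (h0 : 0 < r) (h1 : r < 1) (θ : ℝ) :
    0 < 1 + r ^ 2 + 2 * r * Real.sin θ := by
  nlinarith [Real.neg_one_le_sin θ, sq_pos_of_pos (sub_pos.2 h1)]

theorem one_sub_sq_pos {r : ℝ} (h0 : 0 < r) (h1 : r < 1) : 0 < 1 - r ^ 2 := by nlinarith

theorem moebiusQ_pos {r : ℝ} (h0 : 0 < r) (h1 : r < 1) (θ : ℝ) : 0 < moebiusQ r θ :=
  div_pos (moebius_num_pos h0 h1 θ) (one_sub_sq_pos h0 h1)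

theorem moebiusM_pos {r : ℝ} (h0 : 0 < r) (h1 : r < 1) (θ : ℝ) : 0 < moebiusM r θ :=
  Real.sqrt_pos.2 (moebiusQ_pos h0 h1 θ)

theorem moebiusM_sq {r : ℝ} (h0 : 0 < r) (h1 : r < 1) (θ : ℝ) :
    moebiusM r θ ^ 2 = moebiusQ r θ :=
  Real.sq_sqrt (moebiusQ_pos h0 h1 θ).le

theorem moebiusM_neg_pi (r : ℝ) : moebiusM r (-Real.pi) = moebiusM r Real.pi := by
  simp [moebiusM, moebiusQ]

theorem moebius_pi (r : ℝ) : moebius r Real.pi = moebius r (-Real.pi) + 2 * Real.pi := by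
  simp [moebius]; ring

theorem hasDerivAt_moebiusQ (r θ : ℝ) :
    HasDerivAt (moebiusQ r) (2 * r / (1 - r ^ 2) * Real.cos θ) θ := by
  have := (((Real.hasDerivAt_sin θ).const_mul (2 * r)).const_add (1 + r ^ 2)).div_const (1 - r ^ 2)
  exact this.congr_deriv (by ring)

theorem hasDerivAt_moebiusM {r : ℝ} (h0 : 0 < r) (h1 : r < 1) (θ : ℝ) :
    HasDerivAt (moebiusM r) (r / (1 - r ^ 2) * Real.cos θ / moebiusM r θ) θ := by
  have := (hasDerivAt_moebiusQ r θ).sqrt (moebiusQ_pos h0 h1 θ).ne'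
  refine this.congr_deriv ?_
  have := moebiusM_pos h0 h1 θ
  change _ / (2 * moebiusM r θ) = _
  field_simp

/-- The conformal factor solves the Ermakov–Pinney equation `4 m'' + m = m⁻³`. -/
theorem hasDerivAt_deriv_moebiusM {r : ℝ} (h0 : 0 < r) (h1 : r < 1) (θ : ℝ) :
    HasDerivAt (fun x => r / (1 - r ^ 2) * Real.cos x / moebiusM r x)
      (((moebiusM r θ ^ 3)⁻¹ - moebiusM r θ) / 4) θ := by
  have hm := moebiusM_pos h0 h1 θ
  have hs := moebiusM_sq h0 h1 θ
  have hd := one_sub_sq_pos h0 h1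
  have := ((Real.hasDerivAt_cos θ).const_mul (r / (1 - r ^ 2))).div
    (hasDerivAt_moebiusM h0 h1 θ) hm.ne'
  refine this.congr_deriv ?_
  have hq : moebiusM r θ ^ 2 * (1 - r ^ 2) = 1 + r ^ 2 + 2 * r * Real.sin θ := by
    rw [hs, moebiusQ]; field_simp
  have hsc := Real.sin_sq_add_cos_sq θ
  set m := moebiusM r θ
  set s := Real.sin θ
  set k := Real.cos θ
  have hd' := hd.ne'
  field_simp
  have h4 : m ^ 4 * (1 - r ^ 2) ^ 2 = (1 + r ^ 2 + 2 * r * s) ^ 2 := by rw [← hq]; ring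
  linear_combination h4 - 4 * r * s * hq - 4 * r ^ 2 * hsc

theorem hasDerivAt_moebius {r : ℝ} (h0 : 0 < r) (h1 : r < 1) (θ : ℝ) :
    HasDerivAt (moebius r) ((moebiusM r θ ^ 2)⁻¹) θ := by
  have hD := moebius_denom_pos h0 h1 θ
  have hN := moebius_num_pos h0 h1 θ
  have hd := one_sub_sq_pos h0 h1
  have := (hasDerivAt_id θ).add (((((Real.hasDerivAt_cos θ).const_mul r).div
    (((Real.hasDerivAt_sin θ).const_mul r).const_add 1) hD.ne').arctan).const_mul 2)
  refine this.congr_deriv ?_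
  rw [moebiusM_sq h0 h1, moebiusQ]
  have hsc := Real.sin_sq_add_cos_sq θ
  set s := Real.sin θ
  set k := Real.cos θ
  have hk : k ^ 2 = 1 - s ^ 2 := by linarith
  have e : 1 + (r * k / (1 + r * s)) ^ 2 = (1 + r ^ 2 + 2 * r * s) / (1 + r * s) ^ 2 := by
    field_simp; rw [hk]; ring
  simp only [Pi.div_apply]
  change 1 + 2 * (1 / (1 + (r * k / (1 + r * s)) ^ 2) * _) = _
  rw [e]
  field_simp
  linear_combination (-2 * r ^ 2) * hk

theorem sin_arctan_div {x y : ℝ} (hy : 0 < y) :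
    Real.sin (Real.arctan (x / y)) = x / Real.sqrt (y ^ 2 + x ^ 2) := by
  rw [Real.sin_arctan]
  have : 1 + (x / y) ^ 2 = (y ^ 2 + x ^ 2) / y ^ 2 := by field_simp
  rw [this, Real.sqrt_div (by positivity), Real.sqrt_sq hy.le]
  field_simp

theorem cos_arctan_div {x y : ℝ} (hy : 0 < y) :
    Real.cos (Real.arctan (x / y)) = y / Real.sqrt (y ^ 2 + x ^ 2) := by
  rw [Real.cos_arctan]
  have : 1 + (x / y) ^ 2 = (y ^ 2 + x ^ 2) / y ^ 2 := by field_simp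
  rw [this, Real.sqrt_div (by positivity), Real.sqrt_sq hy.le]
  field_simp

/-- Half the chord between the images of `θ` and `-θ`. The factor `1 - r ^ 2` makes it small unless
the denominator is small too. -/
theorem sin_half_moebius_sub {r : ℝ} (h0 : 0 < r) (h1 : r < 1) (θ : ℝ) :
    Real.sin ((moebius r θ - moebius r (-θ)) / 2) =
      (1 - r ^ 2) * Real.sin θ / (Real.sqrt (1 + r ^ 2 + 2 * r * Real.sin θ) *
        Real.sqrt (1 + r ^ 2 + 2 * r * Real.sin (-θ))) := by
  have hD := moebius_denom_pos h0 h1 θ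
  have hD' := moebius_denom_pos h0 h1 (-θ)
  have hN := Real.sqrt_pos.2 (moebius_num_pos h0 h1 θ)
  have hN' := Real.sqrt_pos.2 (moebius_num_pos h0 h1 (-θ))
  have e : (moebius r θ - moebius r (-θ)) / 2 =
      θ + (Real.arctan (r * Real.cos θ / (1 + r * Real.sin θ)) -
        Real.arctan (r * Real.cos (-θ) / (1 + r * Real.sin (-θ)))) := by
    simp only [moebius]; ring
  have hsc := Real.sin_sq_add_cos_sq θ
  have e1 : ∀ x, (1 + r * Real.sin x) ^ 2 + (r * Real.cos x) ^ 2 =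
      1 + r ^ 2 + 2 * r * Real.sin x := fun x => by
    linear_combination r ^ 2 * Real.sin_sq_add_cos_sq x
  rw [e, Real.sin_add, Real.sin_sub, Real.cos_sub, sin_arctan_div hD, sin_arctan_div hD',
    cos_arctan_div hD, cos_arctan_div hD', e1, e1]
  generalize Real.sqrt (1 + r ^ 2 + 2 * r * Real.sin θ) = p at *
  generalize Real.sqrt (1 + r ^ 2 + 2 * r * Real.sin (-θ)) = p' at *
  rw [Real.sin_neg, Real.cos_neg]
  field_simp
  linear_combination (-r ^ 2 * Real.sin θ) * hsc

/-- For every `N` there is a Möbius map whose conformal factor beats `N` times the chordal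
distance of reflected points. -/
theorem exists_moebius_dominates (N : ℝ) : ∃ r : ℝ, 0 < r ∧ r < 1 ∧
    ∀ θ ∈ Icc 0 Real.pi,
      N * |Real.sin ((moebius r θ - moebius r (-θ)) / 2)| ≤
        Real.log (moebiusM r θ) - Real.log (moebiusM r (-θ)) := by
  wlog hN : 1 ≤ N generalizing N
  · obtain ⟨r, h0, h1, h⟩ := this 1 le_rfl
    refine ⟨r, h0, h1, fun θ hθ => le_trans ?_ (h θ hθ)⟩
    exact mul_le_mul_of_nonneg_right (not_le.1 hN).le (abs_nonneg _)
  -- `δ` will be `1 - r ^ 2`. It is chosen so that the threshold `4 * N * δ` for `w` below equals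
  -- `exp (-N)`.
  set δ := Real.exp (-N) / (4 * N) with hδ
  have hδ0 : 0 < δ := by positivity
  have hδ1 : δ ≤ 1 / 4 := by
    have : Real.exp (-N) ≤ 1 := Real.exp_le_one_iff.2 (by linarith)
    rw [hδ, div_le_iff₀ (by positivity)]; linarith
  obtain ⟨r, hr0, hr⟩ : ∃ r : ℝ, 0 ≤ r ∧ r ^ 2 = 1 - δ :=
    ⟨Real.sqrt (1 - δ), Real.sqrt_nonneg _, Real.sq_sqrt (by linarith)⟩
  have hrh : 1 / 2 ≤ r := by nlinarith
  have h0 : 0 < r := by linarith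
  have h1 : r < 1 := by nlinarith
  refine ⟨r, h0, h1, fun θ hθ => ?_⟩
  have hs0 : 0 ≤ Real.sin θ := Real.sin_nonneg_of_mem_Icc hθ
  have hs1 := Real.sin_le_one θ
  have hP := moebius_num_pos h0 h1 θ
  have hQ := moebius_num_pos h0 h1 (-θ)
  have hlog : Real.log (moebiusM r θ) - Real.log (moebiusM r (-θ)) =
      1 / 2 * (Real.log (1 + r ^ 2 + 2 * r * Real.sin θ) -
        Real.log (1 + r ^ 2 + 2 * r * Real.sin (-θ))) := by
    have hd := one_sub_sq_pos h0 h1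
    rw [moebiusM, moebiusM, Real.log_sqrt (moebiusQ_pos h0 h1 _).le,
      Real.log_sqrt (moebiusQ_pos h0 h1 _).le, moebiusQ, moebiusQ,
      Real.log_div hP.ne' hd.ne', Real.log_div hQ.ne' hd.ne']
    ring
  rw [hlog, sin_half_moebius_sub h0 h1, ← Real.sqrt_mul hP.le]
  rw [Real.sin_neg] at hQ ⊢
  set s := Real.sin θ
  set P := 1 + r ^ 2 + 2 * r * s with hPd
  set Q := 1 + r ^ 2 + 2 * r * -s with hQd
  have hP1 : 1 ≤ P := by nlinarith [mul_nonneg h0.le hs0]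
  have hP4 : P ≤ 4 := by nlinarith [mul_le_mul_of_nonneg_left hs1 h0.le]
  set w := Real.sqrt (P * Q) with hw
  have hw0 : 0 < w := Real.sqrt_pos.2 (mul_pos hP hQ)
  have hw2 : w ^ 2 = P * Q := Real.sq_sqrt (mul_pos hP hQ).le
  have hrδ : 1 - r ^ 2 = δ := by linarith
  rw [hrδ, abs_of_nonneg (by positivity)]
  -- From `log (P / Q) ≥ 1 - Q / P = 4 r s / P` and `P ≤ 4`.
  have hlogle : r * s ≤ Real.log P - Real.log Q := by
    have h := Real.one_sub_inv_le_log_of_pos (div_pos hP hQ)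
    rw [Real.log_div hP.ne' hQ.ne'] at h
    refine le_trans ?_ h
    rw [inv_div, le_sub_iff_add_le, ← le_sub_iff_add_le', div_le_iff₀ hP]
    have : P - Q = 4 * (r * s) := by rw [hPd, hQd]; ring
    nlinarith [mul_nonneg h0.le hs0]
  -- For large `w` the chord term is at most `s / 4 ≤ r s / 2`. For small `w` it is at most `N`,
  -- while half the logarithmic difference is `log P - log w ≥ N`.
  rcases le_total (4 * N * δ) w with hc | hc
  · have : N * (δ * s / w) ≤ s / 4 := by
      rw [mul_div_assoc', div_le_iff₀ hw0]
      nlinarith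
    nlinarith
  · have hwδ : δ ≤ w := by
      have hPQ : δ ^ 2 ≤ P * Q := by
        have : P * Q = δ ^ 2 + 4 * r ^ 2 * (1 - s ^ 2) := by
          rw [hPd, hQd, ← hrδ]; ring
        have h2 : 0 ≤ r ^ 2 * (1 - s ^ 2) := mul_nonneg (sq_nonneg _) (by nlinarith)
        linarith
      exact Real.le_sqrt_of_sq_le hPQ
    have hl : N * (δ * s / w) ≤ N := by
      have : δ * s / w ≤ 1 := by
        rw [div_le_one hw0]; nlinarith
      nlinarith
    have hwe : w ≤ Real.exp (-N) := by
      refine hc.trans (le_of_eq ?_)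
      rw [hδ]; field_simp
    have hlw : Real.log w ≤ -N := by
      rw [← Real.log_exp (-N)]; exact Real.log_le_log hw0 hwe
    have hlw2 : 2 * Real.log w = Real.log P + Real.log Q := by
      rw [← Real.log_mul hP.ne' hQ.ne', ← hw2, Real.log_pow]; norm_num
    have hlP : 0 ≤ Real.log P := Real.log_nonneg hP1
    linarith

/-! ### Conformal covariance of the pull-back. -/

/-- The pull-back `m · (f ∘ M)` of a half-density under a Möbius transformation followed by a
rotation. -/
def pullback (r c : ℝ) (f : ℝ → ℝ) (θ : ℝ) : ℝ := moebiusM r θ * f (moebius r θ + c)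

theorem hasDerivAt_pullback {r : ℝ} (h0 : 0 < r) (h1 : r < 1) (c : ℝ) {f : ℝ → ℝ}
    (hf : Differentiable ℝ f) (θ : ℝ) :
    HasDerivAt (pullback r c f)
      (r / (1 - r ^ 2) * Real.cos θ / moebiusM r θ * f (moebius r θ + c) +
        deriv f (moebius r θ + c) * (moebiusM r θ)⁻¹) θ := by
  have hm := moebiusM_pos h0 h1 θ
  have hM := (hasDerivAt_moebius h0 h1 θ).add_const c
  have := (hasDerivAt_moebiusM h0 h1 θ).mul
    (HasDerivAt.comp θ (hf (moebius r θ + c)).hasDerivAt hM)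
  refine this.congr_deriv ?_
  simp only [Function.comp]
  field_simp

theorem hasDerivAt_deriv_pullback {r : ℝ} (h0 : 0 < r) (h1 : r < 1) (c : ℝ) {f : ℝ → ℝ}
    (hf : Differentiable ℝ f) (hf' : Differentiable ℝ (deriv f)) (θ : ℝ) :
    HasDerivAt (deriv (pullback r c f))
      (((moebiusM r θ ^ 3)⁻¹ - moebiusM r θ) / 4 * f (moebius r θ + c) +
        deriv (deriv f) (moebius r θ + c) * (moebiusM r θ ^ 3)⁻¹) θ := by
  have hm := moebiusM_pos h0 h1 θ
  have hM := (hasDerivAt_moebius h0 h1 θ).add_const c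
  have e : deriv (pullback r c f) = fun θ =>
      r / (1 - r ^ 2) * Real.cos θ / moebiusM r θ * f (moebius r θ + c) +
        deriv f (moebius r θ + c) * (moebiusM r θ)⁻¹ :=
    funext fun x => (hasDerivAt_pullback h0 h1 c hf x).deriv
  rw [e]
  have := ((hasDerivAt_deriv_moebiusM h0 h1 θ).mul
    (HasDerivAt.comp θ (hf (moebius r θ + c)).hasDerivAt hM)).add
    ((HasDerivAt.comp θ (hf' (moebius r θ + c)).hasDerivAt hM).mul
      ((hasDerivAt_moebiusM h0 h1 θ).inv hm.ne'))
  refine this.congr_deriv ?_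
  simp only [Function.comp, Pi.inv_apply]
  field_simp
  ring

/-- Conformal invariance of the scalar curvature. -/
theorem curvature_pullback {r : ℝ} (h0 : 0 < r) (h1 : r < 1) (c : ℝ) {f : ℝ → ℝ}
    (hf : Differentiable ℝ f) (hf' : Differentiable ℝ (deriv f)) (θ : ℝ) :
    pullback r c f θ ^ 3 * (4 * deriv (deriv (pullback r c f)) θ + pullback r c f θ) =
      f (moebius r θ + c) ^ 3 *
        (4 * deriv (deriv f) (moebius r θ + c) + f (moebius r θ + c)) := by
  have hm := moebiusM_pos h0 h1 θ
  rw [(hasDerivAt_deriv_pullback h0 h1 c hf hf' θ).deriv, pullback]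
  field_simp
  ring

/-! ### Passage to the line, and regularity of the flow. -/

/-- The `2π`-periodic function on the line given by a function on the circle. -/
def lift (f : S1 → ℝ) (θ : ℝ) : ℝ := f (θ : S1)

theorem periodic_lift (f : S1 → ℝ) : Function.Periodic (lift f) (2 * Real.pi) := fun θ => by
  simp [lift]

theorem angDeriv_coe (f : S1 → ℝ) (θ : ℝ) : angDeriv f (θ : S1) = deriv (lift f) θ := by
  have : (fun s : ℝ => f ((θ : S1) + (s : S1))) = fun s => lift f (θ + s) := by
    funext s; simp [lift]
  rw [angDeriv, this, deriv_comp_const_add, add_zero]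

theorem scalarCurv_coe (f : S1 → ℝ) (θ : ℝ) :
    scalarCurv f (θ : S1) = lift f θ ^ 3 * (4 * deriv (deriv (lift f)) θ + lift f θ) := by
  have : lift (angDeriv f) = deriv (lift f) := funext fun x => angDeriv_coe f x
  rw [scalarCurv, angDeriv_coe, this]; rfl

namespace IsNormalizedYamabeFlow

variable {u₀ : S1 → ℝ} {u : ℝ → S1 → ℝ}

theorem contDiff_lift (h : IsNormalizedYamabeFlow u₀ u) {t : ℝ} (ht : 0 ≤ t) :
    ContDiff ℝ ∞ (lift (u t)) := by
  have h1 : ContDiff ℝ ∞ fun θ : ℝ => (t, θ) := by fun_prop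
  exact h.smooth.comp_contDiff h1 fun _ => ⟨ht, mem_univ _⟩

theorem lift_pos (h : IsNormalizedYamabeFlow u₀ u) {t : ℝ} (ht : 0 ≤ t) (θ : ℝ) :
    0 < lift (u t) θ := h.pos t ht _

theorem differentiable_lift (h : IsNormalizedYamabeFlow u₀ u) {t : ℝ} (ht : 0 ≤ t) :
    Differentiable ℝ (lift (u t)) := (h.contDiff_lift ht).differentiable (by simp)

theorem contDiff_deriv_lift (h : IsNormalizedYamabeFlow u₀ u) {t : ℝ} (ht : 0 ≤ t) :
    ContDiff ℝ ∞ (deriv (lift (u t))) :=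
  (contDiff_infty_iff_deriv.1 (h.contDiff_lift ht)).2

theorem differentiable_deriv_lift (h : IsNormalizedYamabeFlow u₀ u) {t : ℝ} (ht : 0 ≤ t) :
    Differentiable ℝ (deriv (lift (u t))) := (h.contDiff_deriv_lift ht).differentiable (by simp)

theorem continuousOn_lift (h : IsNormalizedYamabeFlow u₀ u) :
    ContinuousOn (fun q : ℝ × ℝ => lift (u q.1) q.2) (Ici (0 : ℝ) ×ˢ univ) :=
  h.smooth.continuousOn

theorem continuousOn_scalarCurv (h : IsNormalizedYamabeFlow u₀ u) :
    ContinuousOn (fun q : ℝ × ℝ => scalarCurv (u q.1) (q.2 : S1)) (Ici (0 : ℝ) ×ˢ univ) := by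
  have h1 := h.continuousOn_lift
  have h2 := (contDiffOn_partial_deriv (contDiffOn_partial_deriv h.smooth)).continuousOn
  refine ((h1.pow 3).mul ((continuousOn_const (c := (4 : ℝ))).mul h2 |>.add h1)).congr ?_
  rintro ⟨t, θ⟩ -
  exact scalarCurv_coe _ _

theorem continuousOn_arcDensity (h : IsNormalizedYamabeFlow u₀ u) :
    ContinuousOn (fun q : ℝ × ℝ => arcDensity (u q.1) (q.2 : S1)) (Ici (0 : ℝ) ×ˢ univ) :=
  (h.continuousOn_lift.pow 2).inv₀ fun q hq => (pow_pos (h.pos q.1 hq.1 _) 2).ne'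

theorem continuous_slice {f : ℝ × ℝ → ℝ} (hf : ContinuousOn f (Ici (0 : ℝ) ×ˢ univ)) {t : ℝ}
    (ht : 0 ≤ t) : Continuous fun θ => f (t, θ) :=
  hf.comp_continuous (by fun_prop) fun _ => ⟨ht, mem_univ _⟩

theorem exists_bound_slab {f : ℝ × ℝ → ℝ} (hf : ContinuousOn f (Ici (0 : ℝ) ×ˢ univ)) (T a b : ℝ) :
    ∃ K, ∀ t ∈ Icc 0 T, ∀ θ ∈ Icc a b, |f (t, θ)| ≤ K := by
  obtain ⟨K, hK⟩ := (isCompact_Icc.prod isCompact_Icc).exists_bound_of_continuousOn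
    (hf.mono (fun q (hq : q ∈ Icc 0 T ×ˢ Icc a b) => ⟨hq.1.1, mem_univ _⟩))
  exact ⟨K, fun t ht θ hθ => hK (t, θ) ⟨ht, hθ⟩⟩

/-! ### Reflection inequalities and the gradient bound they imply. -/

/-- Reflection inequalities between a solution and its conformal reflection persist along the
flow. -/
theorem pullback_reflect_le (h : IsNormalizedYamabeFlow u₀ u) {r : ℝ} (h0 : 0 < r) (h1 : r < 1)
    (c : ℝ) (hinit : ∀ θ ∈ Icc 0 Real.pi,
      pullback r c (lift (u 0)) (-θ) ≤ pullback r c (lift (u 0)) θ)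
    {t : ℝ} (ht : 0 ≤ t) : ∀ θ ∈ Icc 0 Real.pi,
      pullback r c (lift (u t)) (-θ) ≤ pullback r c (lift (u t)) θ := by
  set v : ℝ → ℝ → ℝ := fun t => pullback r c (lift (u t)) with hv
  have hvpos : ∀ t, 0 ≤ t → ∀ θ, 0 < v t θ := fun t ht θ =>
    mul_pos (moebiusM_pos h0 h1 θ) (h.lift_pos ht _)
  have hMc : Continuous (moebius r) := continuous_iff_continuousAt.2 fun x =>
    (hasDerivAt_moebius h0 h1 x).continuousAt
  have hmc : Continuous (moebiusM r) := continuous_iff_continuousAt.2 fun x =>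
    (hasDerivAt_moebiusM h0 h1 x).continuousAt
  have hvc : ContinuousOn (fun q : ℝ × ℝ => v q.1 q.2) (Ici (0 : ℝ) ×ˢ univ) := by
    refine ContinuousOn.mul (by fun_prop) ?_
    exact h.continuousOn_lift.comp
      (f := fun q : ℝ × ℝ => (q.1, moebius r q.2 + c)) (by fun_prop) fun q hq => ⟨hq.1, mem_univ _⟩
  have hvc' : ContinuousOn (fun q : ℝ × ℝ => v q.1 (-q.2)) (Ici (0 : ℝ) ×ˢ univ) :=
    hvc.comp (f := fun q : ℝ × ℝ => (q.1, -q.2)) (by fun_prop) fun q hq => ⟨hq.1, mem_univ _⟩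
  have hvpi : ∀ t, v t (-Real.pi) = v t Real.pi := fun t => by
    simp only [hv, pullback, moebiusM_neg_pi, moebius_pi]
    rw [add_right_comm, periodic_lift]
  have hRc : ContinuousOn (fun q : ℝ × ℝ => scalarCurv (u q.1) ((moebius r (-q.2) + c : ℝ) : S1))
      (Ici (0 : ℝ) ×ˢ univ) :=
    h.continuousOn_scalarCurv.comp
      (f := fun q : ℝ × ℝ => (q.1, moebius r (-q.2) + c)) (by fun_prop) fun q hq => ⟨hq.1, mem_univ _⟩
  obtain ⟨K, hK⟩ := exists_bound_slab hRc t 0 Real.pi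
  -- The fourth power makes `H` a fixed multiple of a quotient of metric coefficients at two points,
  -- so the mean curvature cancels in its evolution.
  set H : ℝ → ℝ → ℝ := fun t θ => (v t (-θ) / v t θ) ^ 4 with hH
  have hHpos : ∀ t, 0 ≤ t → ∀ θ, 0 < H t θ := fun t ht θ =>
    pow_pos (div_pos (hvpos t ht _) (hvpos t ht _)) 4
  have hmain : ∀ s ∈ Icc 0 t, ∀ θ ∈ Icc 0 Real.pi, H s θ ≤ 1 := by
    refine le_one_of_parabolic (K := K)
      (H' := fun s θ => H s θ * (scalarCurv (u s) ((moebius r (-θ) + c : ℝ) : S1) -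
        scalarCurv (u s) ((moebius r θ + c : ℝ) : S1))) ?_ ?_ ?_ ?_ ?_ ?_
    · exact ((hvc'.div hvc fun q hq => (hvpos q.1 hq.1 q.2).ne').pow 4).mono
        fun q hq => ⟨hq.1.1, mem_univ _⟩
    · intro θ hθ
      exact pow_le_one₀ (div_pos (hvpos 0 le_rfl _) (hvpos 0 le_rfl _)).le
        ((div_le_one (hvpos 0 le_rfl _)).2 (hinit θ hθ))
    · intro s hs
      simp [hH, div_self (hvpos s hs.1 0).ne']
    · intro s hs
      simp [hH, hvpi, div_self (hvpos s hs.1 Real.pi).ne']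
    · intro s hs θ _
      set p : S1 := ((moebius r θ + c : ℝ) : S1)
      set p' : S1 := ((moebius r (-θ) + c : ℝ) : S1)
      have hG : ∀ q, metricCoeff (u s) q ≠ 0 := fun q =>
        inv_ne_zero (pow_pos (h.pos s hs.1.le q) 4).ne'
      have e : (fun s => H s θ) = fun s => (moebiusM r (-θ) / moebiusM r θ) ^ 4 *
          (metricCoeff (u s) p / metricCoeff (u s) p') := by
        funext s
        simp only [hH, hv, pullback, metricCoeff, lift, div_eq_mul_inv, mul_pow, inv_inv,
          mul_inv, inv_pow]
        ring
      have hd := (((h.evolution s hs.1.le p).div (h.evolution s hs.1.le p') (hG p')).const_mul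
        ((moebiusM r (-θ) / moebiusM r θ) ^ 4)).mono (Icc_subset_Ici_self : Icc 0 s ⊆ Ici 0)
      rw [e]
      refine hd.congr_deriv ?_
      rw [congrFun e s]
      field_simp [hG p, hG p']
      ring
    · intro s hs θ hθ hgt hmax
      have hs0 := hs.1.le
      set y : ℝ → ℝ := fun x => v s (-x) with hy
      have hf := h.differentiable_lift hs0
      have hf' := h.differentiable_deriv_lift hs0
      have hv1 : Differentiable ℝ (v s) := fun x =>
        (hasDerivAt_pullback h0 h1 c hf x).differentiableAt
      have hv2 : Differentiable ℝ (deriv (v s)) := fun x =>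
        (hasDerivAt_deriv_pullback h0 h1 c hf hf' x).differentiableAt
      have hy1 : Differentiable ℝ y := hv1.comp differentiable_neg
      have hdy : deriv y = fun x => -deriv (v s) (-x) := funext fun x => deriv_comp_neg (v s) x
      have hddy : ∀ x, deriv (deriv y) x = deriv (deriv (v s)) (-x) := fun x => by
        rw [hdy, deriv.fun_neg, deriv_comp_neg]; ring
      have hy2 : Differentiable ℝ (deriv y) := by
        rw [hdy]; exact (hv2.comp differentiable_neg).neg
      -- With this `ρ`, a local maximum of `y / v` becomes a local minimum, of value zero, of `v - ρ
      -- y`; this allows a linear second-derivative test.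
      set ρ := v s θ / y θ with hρ
      have hyp : ∀ x, 0 < y x := fun x => hvpos s hs0 _
      have hρ0 : 0 < ρ := div_pos (hvpos s hs0 _) (hyp θ)
      have hHρ : H s θ = (ρ ^ 4)⁻¹ := by
        rw [hρ, ← inv_pow, inv_div]
      have hlocmin : IsLocalMin (fun x => v s x - ρ * y x) θ := by
        filter_upwards [hmax] with x hx
        have h2 : y x / v s x ≤ y θ / v s θ :=
          le_of_pow_le_pow_left₀ (by norm_num) (div_pos (hyp θ) (hvpos s hs0 θ)).le hx
        rw [div_le_div_iff₀ (hvpos s hs0 x) (hvpos s hs0 θ)] at h2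
        have h3 : ρ * y θ = v s θ := by rw [hρ]; exact div_mul_cancel₀ _ (hyp θ).ne'
        have h4 : ρ * y x ≤ v s x := by
          rw [hρ, div_mul_eq_mul_div, div_le_iff₀ (hyp θ)]; linarith
        linarith
      have hdd : 0 ≤ deriv (deriv (v s)) θ - ρ * deriv (deriv y) θ := by
        have h2 := deriv_deriv_nonneg_of_isLocalMin
          (hv1.sub (hy1.const_mul ρ)).continuous.continuousAt hlocmin
        have e1 : deriv (fun x => v s x - ρ * y x) = fun x => deriv (v s) x - ρ * deriv y x :=
          funext fun x => ((hv1 x).hasDerivAt.sub ((hy1 x).hasDerivAt.const_mul ρ)).deriv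
        have e2 : deriv (fun x => deriv (v s) x - ρ * deriv y x) θ =
            deriv (deriv (v s)) θ - ρ * deriv (deriv y) θ :=
          ((hv2 θ).hasDerivAt.sub ((hy2 θ).hasDerivAt.const_mul ρ)).deriv
        have e3 : deriv (deriv (v s - fun i => ρ * y i)) θ =
            deriv (deriv (v s)) θ - ρ * deriv (deriv y) θ := by
          rw [← e2, ← e1]; rfl
        linarith
      have hRv : scalarCurv (u s) ((moebius r θ + c : ℝ) : S1) =
          v s θ ^ 3 * (4 * deriv (deriv (v s)) θ + v s θ) := by
        rw [scalarCurv_coe, ← curvature_pullback h0 h1 c hf hf']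
      have hRy : scalarCurv (u s) ((moebius r (-θ) + c : ℝ) : S1) =
          y θ ^ 3 * (4 * deriv (deriv y) θ + y θ) := by
        rw [scalarCurv_coe, ← curvature_pullback h0 h1 c hf hf', hddy]
      -- The curvature expression is homogeneous of degree four and increasing in the second
      -- derivative. As `ρ ^ 4 = 1 / H`, this gives `H' ≤ (H - 1) R(p')` with `p'` the reflected
      -- point, whatever the sign of the curvature.
      have hle : ρ ^ 4 * scalarCurv (u s) ((moebius r (-θ) + c : ℝ) : S1) ≤
          scalarCurv (u s) ((moebius r θ + c : ℝ) : S1) := by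
        rw [hRv, hRy]
        have hvy : v s θ = ρ * y θ := by rw [hρ]; exact (div_mul_cancel₀ _ (hyp θ).ne').symm
        rw [hvy]
        have : 0 ≤ (ρ * y θ) ^ 3 *
            (4 * (deriv (deriv (v s)) θ - ρ * deriv (deriv y) θ)) :=
          mul_nonneg (pow_pos (mul_pos hρ0 (hyp θ)) 3).le (by linarith)
        nlinarith
      have hRK := (le_abs_self _).trans (hK s ⟨hs0, hs.2⟩ θ (Ioo_subset_Icc_self hθ))
      simp only at hRK
      have h5 := mul_le_mul_of_nonneg_left hle (hHpos s hs0 θ).le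
      have h6 : H s θ * ρ ^ 4 = 1 := by rw [hHρ]; exact inv_mul_cancel₀ (pow_pos hρ0 4).ne'
      have h7 : H s θ * (ρ ^ 4 * scalarCurv (u s) ((moebius r (-θ) + c : ℝ) : S1)) =
          scalarCurv (u s) ((moebius r (-θ) + c : ℝ) : S1) := by rw [← mul_assoc, h6, one_mul]
      rw [h7] at h5
      have h8 := mul_le_mul_of_nonneg_right hRK (sub_pos.2 hgt).le
      linarith
  intro θ hθ
  have h2 : v t (-θ) / v t θ ≤ 1 :=
    (pow_le_one_iff_of_nonneg (div_pos (hvpos t ht _) (hvpos t ht _)).le (by norm_num)).1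
      (hmain t ⟨ht, le_rfl⟩ θ hθ)
  exact (div_le_one (hvpos t ht _)).1 h2

/-- A logarithmic gradient bound, from reflection inequalities for all rotations. -/
theorem abs_deriv_le_of_reflect (h : IsNormalizedYamabeFlow u₀ u) {r : ℝ} (h0 : 0 < r)
    (h1 : r < 1) {t : ℝ} (ht : 0 ≤ t)
    (hrefl : ∀ c, ∀ θ ∈ Icc 0 Real.pi,
      pullback r c (lift (u t)) (-θ) ≤ pullback r c (lift (u t)) θ) (x : ℝ) :
    |deriv (lift (u t)) x| ≤ r / (1 - r ^ 2) * lift (u t) x := by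
  have hpi := Real.pi_pos
  have hf := h.differentiable_lift ht
  have hD : ∀ c θ, HasDerivAt
      (fun θ => pullback r c (lift (u t)) θ - pullback r c (lift (u t)) (-θ))
      (deriv (pullback r c (lift (u t))) θ + deriv (pullback r c (lift (u t))) (-θ)) θ := by
    intro c θ
    have hd : ∀ θ, HasDerivAt (pullback r c (lift (u t))) (deriv (pullback r c (lift (u t))) θ) θ :=
      fun θ => (hasDerivAt_pullback h0 h1 c hf θ).differentiableAt.hasDerivAt
    exact ((hd θ).sub ((hd (-θ)).comp θ (hasDerivAt_neg θ))).congr_deriv (by ring)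
  rw [abs_le]
  constructor
  -- The rotation puts the reflection-fixed point `0` over `x`, giving the lower bound.
  · set c := x - moebius r 0 with hc
    have h2 := deriv_nonneg_of_min_right hpi (hD c 0).hasDerivWithinAt fun θ hθ => by
      simpa using hrefl c θ hθ
    rw [neg_zero, (hasDerivAt_pullback h0 h1 c hf 0).deriv, hc, add_sub_cancel] at h2
    have hm := moebiusM_pos h0 h1 0
    have h3 : 0 ≤ (r / (1 - r ^ 2) * lift (u t) x + deriv (lift (u t)) x) * (moebiusM r 0)⁻¹ := by
      rw [Real.cos_zero] at h2
      calc _ ≤ _ := div_nonneg h2 zero_le_two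
        _ = _ := by ring
    have h4 := nonneg_of_mul_nonneg_left h3 (inv_pos.2 hm)
    linarith
  -- The other fixed point `π` lies over `x`; there `cos π = -1` reverses the sign and gives the
  -- upper bound.
  · set c := x - moebius r Real.pi with hc
    have hcneg : moebius r (-Real.pi) + c = x - 2 * Real.pi := by
      rw [hc, moebius_pi]; ring
    have hper := periodic_lift (u t)
    have hper' : Function.Periodic (deriv (lift (u t))) (2 * Real.pi) := fun y => by
      rw [← deriv_comp_add_const]; congr 1; exact funext hper
    have hval : pullback r c (lift (u t)) (-Real.pi) = pullback r c (lift (u t)) Real.pi := by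
      rw [pullback, pullback, moebiusM_neg_pi, hcneg, hper.sub_eq, hc, add_sub_cancel]
    have h2 := deriv_nonneg_of_max_left hpi (hD c Real.pi).neg.hasDerivWithinAt fun θ hθ => by
      simpa [hval] using hrefl c θ hθ
    rw [(hasDerivAt_pullback h0 h1 c hf _).deriv, (hasDerivAt_pullback h0 h1 c hf _).deriv,
      hcneg, hper.sub_eq, hper'.sub_eq, moebiusM_neg_pi, Real.cos_neg, Real.cos_pi, hc,
      add_sub_cancel] at h2
    have hm := moebiusM_pos h0 h1 Real.pi
    have h3 : 0 ≤ (r / (1 - r ^ 2) * lift (u t) x - deriv (lift (u t)) x) *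
        (moebiusM r Real.pi)⁻¹ := by
      calc _ ≤ _ := div_nonneg h2 zero_le_two
        _ = _ := by ring
    have h4 := nonneg_of_mul_nonneg_left h3 (inv_pos.2 hm)
    linarith

/-! ### Conservation of length and control of `u` from its logarithmic gradient. -/

theorem continuous_arcDensity (h : IsNormalizedYamabeFlow u₀ u) {t : ℝ} (ht : 0 ≤ t) :
    Continuous fun θ : ℝ => arcDensity (u t) (θ : S1) :=
  continuous_slice h.continuousOn_arcDensity ht

theorem continuous_scalarCurv (h : IsNormalizedYamabeFlow u₀ u) {t : ℝ} (ht : 0 ≤ t) :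
    Continuous fun θ : ℝ => scalarCurv (u t) (θ : S1) :=
  continuous_slice h.continuousOn_scalarCurv ht

theorem arcDensity_pos (h : IsNormalizedYamabeFlow u₀ u) {t : ℝ} (ht : 0 ≤ t) (p : S1) :
    0 < arcDensity (u t) p :=
  inv_pos.2 (pow_pos (h.pos t ht p) 2)

theorem arcLength_pos (h : IsNormalizedYamabeFlow u₀ u) {t : ℝ} (ht : 0 ≤ t) :
    0 < arcLength (u t) :=
  intervalIntegral.intervalIntegral_pos_of_pos
    ((h.continuous_arcDensity ht).intervalIntegrable _ _)
    (fun _ => h.arcDensity_pos ht _) Real.two_pi_pos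

/-- Supplies the uniform domination needed to differentiate the length under the integral. -/
theorem abs_meanScalarCurv_le (h : IsNormalizedYamabeFlow u₀ u) {t K : ℝ} (ht : 0 ≤ t)
    (hK : ∀ θ ∈ Icc 0 (2 * Real.pi), |scalarCurv (u t) (θ : S1)| ≤ K) :
    |meanScalarCurv (u t)| ≤ K := by
  have hL := h.arcLength_pos ht
  rw [meanScalarCurv, abs_div, abs_of_pos hL, div_le_iff₀ hL, arcLength, integral, integral,
    ← intervalIntegral.integral_const_mul, ← Real.norm_eq_abs]
  refine intervalIntegral.norm_integral_le_of_norm_le (μ := MeasureTheory.volume) Real.two_pi_pos.le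
    (Filter.Eventually.of_forall fun θ hθ => ?_)
    (((h.continuous_arcDensity ht).const_mul K).intervalIntegrable _ _)
  rw [Real.norm_eq_abs, abs_mul, abs_of_pos (h.arcDensity_pos ht _)]
  exact mul_le_mul_of_nonneg_right (hK θ (Ioc_subset_Icc_self hθ)) (h.arcDensity_pos ht _).le

theorem hasDerivWithinAt_arcDensity (h : IsNormalizedYamabeFlow u₀ u) {t : ℝ} (ht : 0 ≤ t)
    (p : S1) : HasDerivWithinAt (fun s => arcDensity (u s) p)
      ((meanScalarCurv (u t) - scalarCurv (u t) p) * arcDensity (u t) p / 2) (Ici 0) t := by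
  have e : ∀ s, arcDensity (u s) p = Real.sqrt (metricCoeff (u s) p) := fun s => by
    have : metricCoeff (u s) p = arcDensity (u s) p ^ 2 := by
      rw [metricCoeff, arcDensity, inv_pow, ← pow_mul]
    rw [this, Real.sqrt_sq]
    exact inv_nonneg.2 (sq_nonneg _)
  have hu := h.pos t ht p
  have hG : metricCoeff (u t) p ≠ 0 := inv_ne_zero (pow_pos hu 4).ne'
  have hd := (h.evolution t ht p).sqrt hG
  rw [funext e]
  refine hd.congr_deriv ?_
  rw [← e, arcDensity, metricCoeff]
  field_simp

/-- The derivative is half the integral of mean curvature minus curvature against `dσ`, which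
vanishes by definition of the mean. -/
theorem hasDerivAt_arcLength (h : IsNormalizedYamabeFlow u₀ u) {t : ℝ} (ht : 0 < t) :
    HasDerivAt (fun s => arcLength (u s)) 0 t := by
  have hL := h.arcLength_pos ht.le
  obtain ⟨K, hK⟩ := exists_bound_slab h.continuousOn_scalarCurv (t + 1) 0 (2 * Real.pi)
  obtain ⟨D, hD⟩ := exists_bound_slab h.continuousOn_arcDensity (t + 1) 0 (2 * Real.pi)
  have hmain := intervalIntegral.hasDerivAt_integral_of_dominated_loc_of_deriv_le
    (μ := MeasureTheory.volume) (a := 0) (b := 2 * Real.pi)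
    (F := fun s θ => arcDensity (u s) (θ : S1))
    (F' := fun s θ => (meanScalarCurv (u s) - scalarCurv (u s) (θ : S1)) *
      arcDensity (u s) (θ : S1) / 2)
    (bound := fun _ => (K + K) * D / 2) (x₀ := t) (s := Ioo 0 (t + 1))
    (Ioo_mem_nhds ht (by linarith)) ?_ ?_ ?_ ?_ ?_ ?_
  · have hc1 := h.continuous_arcDensity ht.le
    have hc2 := h.continuous_scalarCurv ht.le
    refine hmain.2.congr_deriv ?_
    simp only [sub_mul, sub_div, mul_div_assoc]
    rw [intervalIntegral.integral_sub (Continuous.intervalIntegrable (by fun_prop) _ _)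
      (Continuous.intervalIntegrable (by fun_prop) _ _)]
    simp only [← mul_div_assoc]
    rw [intervalIntegral.integral_div, intervalIntegral.integral_div,
      intervalIntegral.integral_const_mul]
    change meanScalarCurv (u t) * arcLength (u t) / 2 -
      integral (fun p => scalarCurv (u t) p * arcDensity (u t) p) / 2 = 0
    rw [meanScalarCurv, div_mul_cancel₀ _ hL.ne', sub_self]
  · filter_upwards [Ioi_mem_nhds ht] with s hs
    exact (h.continuous_arcDensity (le_of_lt hs)).aestronglyMeasurable
  · exact (h.continuous_arcDensity ht.le).intervalIntegrable _ _
  · have hc1 := h.continuous_arcDensity ht.le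
    have hc2 := h.continuous_scalarCurv ht.le
    exact Continuous.aestronglyMeasurable (by fun_prop)
  · refine Filter.Eventually.of_forall fun θ hθ s hs => ?_
    rw [uIoc_of_le Real.two_pi_pos.le] at hθ
    have hθ' := Ioc_subset_Icc_self hθ
    have hs' : s ∈ Icc 0 (t + 1) := Ioo_subset_Icc_self hs
    have hm := h.abs_meanScalarCurv_le hs.1.le fun θ hθ => hK s hs' θ hθ
    rw [Real.norm_eq_abs, abs_div, abs_mul, abs_two]
    have h1 := (abs_sub _ _).trans (add_le_add hm (hK s hs' θ hθ'))
    have h2 := hD s hs' θ hθ'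
    gcongr
    exact (abs_nonneg _).trans h1
  · exact intervalIntegrable_const
  · refine Filter.Eventually.of_forall fun θ _ s hs => ?_
    exact (h.hasDerivWithinAt_arcDensity hs.1.le _).hasDerivAt (Ici_mem_nhds hs.1)

/-- The flow preserves the length. -/
theorem arcLength_eq (h : IsNormalizedYamabeFlow u₀ u) {t : ℝ} (ht : 0 ≤ t) :
    arcLength (u t) = 2 * Real.pi := by
  rcases ht.eq_or_lt with rfl | hpos
  · exact h.length_initial
  -- Freezing negative times at `0` gives a globally continuous integrand, as `u` is arbitrary
  -- there.
  have hc : Continuous (Function.uncurry fun (s θ : ℝ) => arcDensity (u (max s 0)) (θ : S1)) :=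
    h.continuousOn_arcDensity.comp_continuous (f := fun q : ℝ × ℝ => (max q.1 0, q.2))
      (by fun_prop) fun q => ⟨mem_Ici.2 (le_max_right _ _), mem_univ _⟩
  have hL := intervalIntegral.continuous_parametric_intervalIntegral_of_continuous'
    (μ := MeasureTheory.volume) hc 0 (2 * Real.pi)
  have hLc : ContinuousOn (fun s => arcLength (u s)) (Icc 0 t) :=
    hL.continuousOn.congr fun s hs => by
      simp only [max_eq_left hs.1]; rfl
  obtain ⟨s, -, hs⟩ := exists_hasDerivAt_eq_slope (fun s => arcLength (u s)) (fun _ => 0) hpos hLc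
    fun s hs => h.hasDerivAt_arcLength hs.1
  have h2 := (div_eq_zero_iff.1 hs.symm).resolve_right (by linarith)
  rw [← h.length_initial]
  linarith

/-- The solution takes the value `1` at every time. -/
theorem exists_lift_eq_one (h : IsNormalizedYamabeFlow u₀ u) {t : ℝ} (ht : 0 ≤ t) :
    ∃ θ, lift (u t) θ = 1 := by
  have hc := h.continuous_arcDensity ht
  have hd : ∀ x : ℝ, HasDerivAt (fun x => ∫ θ in (0 : ℝ)..x, arcDensity (u t) (θ : S1))
      (arcDensity (u t) (x : S1)) x := fun x => hc.integral_hasStrictDerivAt 0 x |>.hasDerivAt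
  -- Mean value theorem for the cumulative length: the average density is `1`.
  obtain ⟨θ, -, hθ⟩ := exists_hasDerivAt_eq_slope _ _ Real.two_pi_pos
    (fun x _ => (hd x).continuousAt.continuousWithinAt) fun x _ => hd x
  refine ⟨θ, ?_⟩
  have hL := h.arcLength_eq ht
  rw [arcLength, integral] at hL
  rw [hL, intervalIntegral.integral_same, sub_zero, div_self Real.two_pi_pos.ne', arcDensity,
    inv_eq_one] at hθ
  exact (pow_eq_one_iff_of_nonneg (h.pos t ht (θ : S1)).le two_ne_zero).1 hθ

/-- Used at time `0` to start the reflection argument, and at time `t` to turn the gradient bound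
into bounds on `u`. -/
theorem abs_deriv_log_le (h : IsNormalizedYamabeFlow u₀ u) {t B : ℝ} (ht : 0 ≤ t)
    (hB : ∀ x, |deriv (lift (u t)) x| ≤ B * lift (u t) x) (x y : ℝ) :
    |Real.log (lift (u t) x) - Real.log (lift (u t) y)| ≤
      B * Real.pi * |Real.sin ((x - y) / 2)| := by
  have hp := h.lift_pos ht
  have hd := h.differentiable_lift ht
  refine abs_sub_le_of_periodic (f := fun x => Real.log (lift (u t) x))
    (hd.log fun x => (hp x).ne') (fun x => by simp only [periodic_lift (u t) x]) (fun x => ?_) x y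
  rw [((hd x).hasDerivAt.log (hp x).ne').deriv, abs_div, abs_of_pos (hp x), div_le_iff₀ (hp x)]
  exact hB x

/-- On the initial slice the logarithmic derivative is bounded. -/
theorem exists_initial_bound (h : IsNormalizedYamabeFlow u₀ u) :
    ∃ L, ∀ x, |deriv (lift u₀) x| ≤ L * lift u₀ x := by
  have hp := h.lift_pos le_rfl
  have hd := h.contDiff_deriv_lift le_rfl
  have hd' := h.differentiable_lift le_rfl
  rw [h.initial] at hp hd hd'
  have hper := periodic_lift u₀
  have hper' : Function.Periodic (deriv (lift u₀)) (2 * Real.pi) := fun y => by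
    rw [← deriv_comp_add_const]; congr 1; exact funext hper
  obtain ⟨L, hL⟩ := exists_abs_le_of_periodic Real.two_pi_pos
    (hd.continuous.div hd'.continuous fun x => (hp x).ne')
    (fun x => by simp only [Pi.div_apply]; rw [hper, hper'])
  refine ⟨L, fun x => ?_⟩
  have := hL x
  rwa [Pi.div_apply, abs_div, abs_of_pos (hp x), div_le_iff₀ (hp x)] at this

end IsNormalizedYamabeFlow

/-- The logarithmic gradient is bounded along the flow by a constant that depends only on a bound
for the logarithmic gradient of the initial value. -/
theorem exists_gradient_bound (u₀ : S1 → ℝ) {L : ℝ}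
    (hL : ∀ x, |deriv (lift u₀) x| ≤ L * lift u₀ x) :
    ∃ B, 0 < B ∧ ∀ u, IsNormalizedYamabeFlow u₀ u → ∀ t, 0 ≤ t → ∀ x,
      |deriv (lift (u t)) x| ≤ B * lift (u t) x := by
  obtain ⟨r, h0, h1, hr⟩ := exists_moebius_dominates (L * Real.pi)
  refine ⟨r / (1 - r ^ 2), div_pos h0 (one_sub_sq_pos h0 h1), fun u h t ht x => ?_⟩
  refine h.abs_deriv_le_of_reflect h0 h1 ht (fun c => h.pullback_reflect_le h0 h1 c ?_ ht) x
  intro θ hθ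
  rw [← h.initial] at hL
  have hp := h.lift_pos le_rfl
  have h2 := h.abs_deriv_log_le le_rfl hL (moebius r (-θ) + c) (moebius r θ + c)
  have h3 := hr θ hθ
  have e : |Real.sin ((moebius r (-θ) + c - (moebius r θ + c)) / 2)| =
      |Real.sin ((moebius r θ - moebius r (-θ)) / 2)| := by
    rw [← abs_neg, ← Real.sin_neg]; congr 2; ring
  rw [e] at h2
  have h4 := (le_abs_self _).trans h2
  have hm := moebiusM_pos h0 h1
  rw [pullback, pullback, ← Real.log_le_log_iff (mul_pos (hm _) (hp _)) (mul_pos (hm _) (hp _)),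
    Real.log_mul (hm _).ne' (hp _).ne', Real.log_mul (hm _).ne' (hp _).ne']
  linarith

end

end YamabeFlow

theorem proposition3p1 (u₀ : YamabeFlow.S1 → ℝ) :
    ∃ C : ℝ, 0 < C ∧ ∀ u : ℝ → YamabeFlow.S1 → ℝ, YamabeFlow.IsNormalizedYamabeFlow u₀ u →
      ∀ t : ℝ, 0 ≤ t → ∀ p : YamabeFlow.S1,
        YamabeFlow.gradNorm (u t) p / u t p ≤ C ∧ 1 / C ≤ u t p ∧ u t p ≤ C := by
  -- Smoothness and positivity of `u₀` are read off from some flow starting at it; without one the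
  -- claim is vacuous. The bound `L` concerns `u₀` alone, so it serves every flow.
  by_cases hex : ∃ u, YamabeFlow.IsNormalizedYamabeFlow u₀ u
  swap
  · exact ⟨1, one_pos, fun u hu => absurd ⟨u, hu⟩ hex⟩
  obtain ⟨w, hw⟩ := hex
  obtain ⟨L, hL⟩ := hw.exists_initial_bound
  obtain ⟨B, hB0, hB⟩ := YamabeFlow.exists_gradient_bound u₀ hL
  have hE := Real.exp_pos (B * Real.pi)
  -- `B` bounds the gradient quotient. Since `u = 1` somewhere, `|log u| ≤ B π`, and `exp (B π)`
  -- bounds both `u` and `1 / u`.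
  refine ⟨B + Real.exp (B * Real.pi), by positivity, fun u h t ht p => ?_⟩
  obtain ⟨θ, rfl⟩ := QuotientAddGroup.mk_surjective p
  have hp : 0 < YamabeFlow.lift (u t) θ := h.lift_pos ht θ
  obtain ⟨η, hη⟩ := h.exists_lift_eq_one ht
  have h2 := h.abs_deriv_log_le ht (hB u h t ht) θ η
  rw [hη, Real.log_one, sub_zero] at h2
  have h3 : |Real.log (YamabeFlow.lift (u t) θ)| ≤ B * Real.pi :=
    h2.trans (mul_le_of_le_one_right (by positivity) (Real.abs_sin_le_one _))
  obtain ⟨h4, h5⟩ := abs_le.1 h3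
  rw [Real.le_log_iff_exp_le hp, Real.exp_neg] at h4
  rw [Real.log_le_iff_le_exp hp] at h5
  refine ⟨?_, ?_, ?_⟩
  · change |YamabeFlow.angDeriv (u t) (θ : YamabeFlow.S1)| / YamabeFlow.lift (u t) θ ≤ _
    rw [YamabeFlow.angDeriv_coe, div_le_iff₀ hp]
    exact (hB u h t ht θ).trans (mul_le_mul_of_nonneg_right (by linarith) hp.le)
  · refine le_trans ?_ h4
    rw [one_div]
    exact inv_anti₀ hE (by linarith)
  · change YamabeFlow.lift (u t) θ ≤ _
    linarith
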